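/- All graphs are finite, simple and undirected, and $\log$ is to base $2$. A rooted forest on a vertex set $V$ is identified with its ancestor order $\preceq$ on $V$; its height is the maximum number of vertices on a $\preceq$-chain. A forest cover of $G$ is a rooted forest on $V(G)$ such that the ends of every edge of $G$ are $\preceq$-comparable. $\mathcal{TD}_q$ is the class of graphs of treedepth at most $q$, that is, having a forest cover of height at most $q$, and $\mathcal{TW}_w$ is the class of graphs of treewidth at most $w$. $\mathcal{T}^k_q$ is the class of graphs $G$ that admit a $k$-pebble forest cover of depth at most $q$, that is, a forest cover of height at most $q$ with a map $p\colon V(G)\to\{1,\dots,k\}$ such that whenever $uv\in E(G)$, $u\prec v$ and $u\prec w\preceq v$, then $p(u)\neq p(w)$. The $q$-round $k$-cops-and-robber game on $G$ (non-monotone version) is played on $G$ together with a disjoint $k$-vertex clique $K$. The $k$ cops start on $X_1=K$, and Robber chooses a start vertex $v_1\in V(G)$. In round $i$ (for $1\le i\le q$), Cops announces a $k$-set $X_{i+1}\subseteq V(G)\cup K$ with $|X_i\cap X_{i+1}|=k-1$, and then Robber moves from $v_i$ to some $v_{i+1}\in V(G)$ along a path that avoids $X_i\cap X_{i+1}$;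 Robber is captured if $v_{i+1}\in X_{i+1}$. Robber wins if he can avoid capture in all $q$ rounds. **Theorem.** Let $q\ge 3$. 1. For every $k$ with $2\le k-1\le \frac{q}{3+\log q}$ we have $$\mathcal{T}^k_q\subsetneq \mathcal{TW}_{k-1}\cap\mathcal{TD}_q .$$ Moreover, there is an $\ell$ such that the $(k-1)\times\ell$ grid lies in $(\mathcal{TW}_{k-1}\cap\mathcal{TD}_q)\setminus\mathcal{T}^k_q$ and Robber wins the $q$-round $k$-cops-and-robber game on it. 2. We have $$\mathcal{T}^2_q\subsetneq \mathcal{TW}_1\cap\mathcal{TD}_q .$$ Moreover, the path on $2^q-1$ vertices lies in $(\mathcal{TW}_1\cap\mathcal{TD}_q)\setminus\mathcal{T}^2_q$, and Robber wins the $q$-round $2$-cops-and-robber game on it. -/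

import Mathlib

open scoped SimpleGraph

namespace PebbleGraphs

/-- A finite simple graph: a finite set of vertices with an irreflexive symmetric adjacency. -/
structure FinGraph where
  verts : Type
  [fintypeVerts : Fintype verts]
  graph : SimpleGraph verts

attribute [instance] FinGraph.fintypeVerts

/-- A simple graph on a finite vertex type, as a member of the class of all finite graphs. -/
abbrev FinGraph.of {V : Type} [Fintype V] (G : SimpleGraph V) : FinGraph where
  verts := V
  graph := G

/-! ### Treewidth -/

/-- A tree decomposition of `G`: a finite tree together with a bag of vertices at each node. -/
structure TreeDecomposition {V : Type} (G : SimpleGraph V) where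
  node : Type
  [fintypeNode : Fintype node]
  tree : SimpleGraph node
  isTree : tree.IsTree
  bag : node → Finset V
  exists_mem_bag : ∀ v : V, ∃ t, v ∈ bag t
  exists_adj_mem_bag : ∀ u v : V, G.Adj u v → ∃ t, u ∈ bag t ∧ v ∈ bag t
  connected : ∀ v : V, (tree.induce {t | v ∈ bag t}).Connected

attribute [instance] TreeDecomposition.fintypeNode

/-- The width of a tree decomposition: the maximum size of a bag, minus one. -/
def TreeDecomposition.width {V : Type} {G : SimpleGraph V} (D : TreeDecomposition G) : ℤ :=
  ((Finset.univ.sup fun t => (D.bag t).card : ℕ) : ℤ) - 1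

/-- The class `TW_w` of the finite graphs of treewidth at most `w`. -/
def TW (w : ℕ) : Set FinGraph :=
  {G | ∃ D : TreeDecomposition G.graph, D.width ≤ (w : ℤ)}

/-! ### Treedepth -/

/-- A rooted forest with vertex set `V`, given by its ancestor order: `le u v` says that `u` lies
on the path from the root of the component of `v` to `v`. The roots are the minimal elements. -/
structure RootedForest (V : Type) where
  le : V → V → Prop
  refl : ∀ v, le v v
  antisymm : ∀ u v, le u v → le v u → u = v
  trans : ∀ u v w, le u v → le v w → le u w
  comparable : ∀ u u' v, le u v → le u' v → le u u' ∨ le u' u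

/-- The strict ancestor relation. -/
def RootedForest.lt {V : Type} (F : RootedForest V) (u v : V) : Prop :=
  F.le u v ∧ u ≠ v

open Classical in
/-- The height of a rooted forest: the maximum number of vertices of a chain of `le`. -/
noncomputable def RootedForest.height {V : Type} [Fintype V] (F : RootedForest V) : ℕ :=
  (Finset.univ.filter fun s : Finset V => IsChain F.le (s : Set V)).sup Finset.card

/-- `F` is a forest cover of `G`: the ends of each edge are related in the ancestor order. -/
def IsForestCover {V : Type} (G : SimpleGraph V) (F : RootedForest V) : Prop :=
  ∀ u v, G.Adj u v → F.le u v ∨ F.le v u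

/-- The class `TD_q` of the finite graphs of treedepth at most `q`. -/
def TD (q : ℕ) : Set FinGraph :=
  {G | ∃ F : RootedForest G.verts, IsForestCover G.graph F ∧ F.height ≤ q}

/-! ### Pebble forest covers -/

/-- `(F, p)` is a `k`-pebble forest cover of `G`. -/
def IsPebbleForestCover {V : Type} {k : ℕ} (G : SimpleGraph V) (F : RootedForest V)
    (p : V → Fin k) : Prop :=
  IsForestCover G F ∧
    ∀ u v, G.Adj u v → F.lt u v → ∀ w, F.lt u w → F.le w v → p u ≠ p w

/-- The class `T^k_q` of the finite graphs with a `k`-pebble forest cover of depth at most `q`. -/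
def PebbleClass (k q : ℕ) : Set FinGraph :=
  {G | ∃ (F : RootedForest G.verts) (p : G.verts → Fin k),
    IsPebbleForestCover G.graph F p ∧ F.height ≤ q}

/-! ### The cops-and-robber game (without the monotonicity condition) -/

/-- The board: `G` together with a disjoint clique on `k` vertices. -/
abbrev board {V : Type} (G : SimpleGraph V) (k : ℕ) : SimpleGraph (V ⊕ Fin k) :=
  G ⊕g (⊤ : SimpleGraph (Fin k))

/-- The robber can move from `v` to `v'` along a path of the board that avoids the set `Y`
(the vertices occupied by cops both before and after the current move of the cops). -/
def RobberMove {V : Type} (G : SimpleGraph V) (k : ℕ) (Y : Finset (V ⊕ Fin k)) (v v' : V) : Prop :=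
  ∃ P : (board G k).Walk (Sum.inl v) (Sum.inl v'), P.IsPath ∧ ∀ x ∈ P.support, x ∉ Y

/-- From the position with cops on `X` and robber on `v`, Robber can avoid capture for the given
number of further rounds. In each round Cops moves exactly one of the `k` cops, announcing the new
position `X'`; then Robber moves to some `v'`, and he is captured if `v'` is in `X'`. -/
def RobberSurvives {V : Type} [DecidableEq V] (G : SimpleGraph V) (k : ℕ) :
    ℕ → Finset (V ⊕ Fin k) → V → Prop
  | 0, _, _ => True
  | n + 1, X, v => ∀ X' : Finset (V ⊕ Fin k), X'.card = k → (X ∩ X').card + 1 = k →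
      ∃ v' : V, RobberMove G k (X ∩ X') v v' ∧ Sum.inl v' ∉ X' ∧ RobberSurvives G k n X' v'

/-- Robber wins the `q`-round `k`-cops-and-robber game on `G`: the cops start on the added clique,
Robber chooses his first vertex, and he is not captured within `q` rounds. -/
def RobberWins {V : Type} [DecidableEq V] (G : SimpleGraph V) (k q : ℕ) : Prop :=
  ∃ v : V, RobberSurvives G k q (Finset.univ.map Function.Embedding.inr) v

/-- The grid with `h` rows and `l` columns. -/
abbrev grid (h l : ℕ) : SimpleGraph (Fin h × Fin l) :=
  SimpleGraph.pathGraph h □ SimpleGraph.pathGraph l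

end PebbleGraphs

open PebbleGraphs

namespace PebbleGraphs

/-! A pebble forest cover yields a tree decomposition: the bag at `v` holds the ancestors of `v`,
itself included, whose pebble has not been reused on the way to `v`. This is
`IsPebbleForestCover.mem_TW` and gives the inclusions. A cover of height at most `q` also tells the
cops how to catch Robber within `q` rounds (`CopState.not_robberSurvives`), so strictness needs only
graphs of small treewidth and treedepth on which Robber survives. Long thin graphs have both
properties. Treedepth grows logarithmically with the length, by repeatedly removing a middle column
(`mem_TD_of_layers`). The game is linear in the length: cops that block a grid with `h = k - 1` rows
use all but one of their number on the barrier, so the barrier shifts by at most one column per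
round (`IsBarrier.exists_close`, `IsSafe.exists_next`). On a path the margin of a cop likewise drops
by one per round (`exists_safe_of_two_cops`). Length `4 * q` is long enough for Robber on the grid
and short enough for treedepth `q`. -/

/-! ### The cops' strategy given by a pebble forest cover. -/

theorem RootedForest.height_le_iff {V : Type} [Fintype V] (F : RootedForest V) (q : ℕ) :
    F.height ≤ q ↔ ∀ s : Finset V, IsChain F.le (s : Set V) → s.card ≤ q := by
  simp [RootedForest.height]

theorem RootedForest.lt_of_lt_of_le {V : Type} (F : RootedForest V) {u v w : V}
    (h : F.lt u v) (h' : F.le v w) : F.lt u w := by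
  refine ⟨F.trans _ _ _ h.1 h', ?_⟩
  rintro rfl
  exact h.2 (F.antisymm _ _ h.1 h')

theorem RootedForest.wellFounded_lt {V : Type} [Finite V] (F : RootedForest V) :
    WellFounded F.lt := by
  have : IsTrans V F.lt := ⟨fun _ _ _ h h' => F.lt_of_lt_of_le h h'.1⟩
  have : Std.Irrefl F.lt := ⟨fun _ h => h.2 rfl⟩
  exact Finite.wellFounded_of_trans_of_irrefl _

/-- A set of vertices that can only be left through `Y` confines the robber. -/
theorem RobberMove.mem_of_closed {V : Type} {G : SimpleGraph V} {k : ℕ} {Y : Finset (V ⊕ Fin k)}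
    {v v' : V} (h : RobberMove G k Y v v') {S : Set V} (hv : v ∈ S)
    (hS : ∀ a ∈ S, ∀ b, G.Adj a b → Sum.inl b ∉ Y → b ∈ S) : v' ∈ S := by
  obtain ⟨P, -, hP⟩ := h
  suffices H : ∀ (x y : V ⊕ Fin k) (P : (board G k).Walk x y), (∀ z ∈ P.support, z ∉ Y) →
      x ∈ Sum.inl '' S → y ∈ Sum.inl '' S by
    simpa using H _ _ P hP ⟨v, hv, rfl⟩
  intro x y P hP hx
  induction P with
  | nil => exact hx
  | @cons x z y hxz P ih =>
    refine ih (fun a ha => hP a (by simp [ha])) ?_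
    obtain ⟨a, ha, rfl⟩ := hx
    have hz : z ∉ Y := hP z (by simp)
    cases z with
    | inl b => exact ⟨b, hS a ha b (by simpa using hxz) hz, rfl⟩
    | inr b => simp at hxz

/-- The cops have been placed on the vertices of a down-closed set `A`, from the root on, where
the cop numbered `p u` is used for `u`; those not yet used stay on the added clique. -/
structure CopState {V : Type} {k : ℕ} (F : RootedForest V) (p : V → Fin k) (A : Finset V)
    (pos : Fin k → V ⊕ Fin k) : Prop where
  lower : ∀ a ∈ A, ∀ u, F.le u a → u ∈ A
  pos_eq : ∀ u ∈ A, (∀ w ∈ A, F.lt u w → p u ≠ p w) → pos (p u) = Sum.inl u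
  pos_cases : ∀ j, pos j = Sum.inr j ∨ ∃ u ∈ A, p u = j ∧ pos j = Sum.inl u

theorem CopState.injective {V : Type} {k : ℕ} {F : RootedForest V} {p : V → Fin k} {A : Finset V}
    {pos : Fin k → V ⊕ Fin k} (h : CopState F p A pos) : Function.Injective pos := by
  intro i j hij
  rcases h.pos_cases i with hi | ⟨u, -, hu, hi⟩ <;> rcases h.pos_cases j with hj | ⟨w, -, hw, hj⟩ <;>
    rw [hi, hj] at hij
  · simpa using hij
  · simp at hij
  · simp at hij
  · rw [← hu, ← hw, Sum.inl_injective hij]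

/-- The cops climb the branch towards Robber: each round occupies the lowest free ancestor `w` of
`v` with the cop `p w`. Robber stays in the subtree of `w`, since an exit would be an ancestor `b`
of `w` with a neighbour in that subtree, and the pebble condition keeps the cop `p b` on `b`. The
chain `A` grows by one per round, and the height bounds it. -/
theorem CopState.not_robberSurvives {V : Type} [Fintype V] [DecidableEq V] {G : SimpleGraph V}
    {k q : ℕ} {F : RootedForest V} {p : V → Fin k} (hF : IsPebbleForestCover G F p)
    (hq : F.height ≤ q) (n : ℕ) : ∀ (A : Finset V) (pos : Fin k → V ⊕ Fin k) (v : V),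
      CopState F p A pos → (∀ a ∈ A, F.lt a v) → q ≤ A.card + n →
      ¬ RobberSurvives G k n (Finset.univ.image pos) v := by
  induction n with
  | zero =>
    intro A pos v _ hv hA
    exfalso
    -- `A` together with `v` is a chain of more than `q` vertices.
    have hle : ∀ a ∈ insert v A, F.le a v := by
      intro a ha
      rcases Finset.mem_insert.1 ha with rfl | ha
      · exact F.refl _
      · exact (hv a ha).1
    have hvA : v ∉ A := fun h => (hv v h).2 rfl
    have := (F.height_le_iff q).1 hq (insert v A)
      (fun a ha b hb _ => F.comparable _ _ v (hle a ha) (hle b hb))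
    rw [Finset.card_insert_of_notMem hvA] at this
    omega
  | succ n ih =>
    intro A pos v hs hv hA hsurv
    have hvA : v ∉ A := fun h => (hv v h).2 rfl
    obtain ⟨w, ⟨hwv, hwA⟩, hmin⟩ :=
      F.wellFounded_lt.has_min {u | F.le u v ∧ u ∉ A} ⟨v, F.refl v, hvA⟩
    have hbelow : ∀ u, F.lt u w → u ∈ A := fun u hu => by
      by_contra h
      exact hmin u ⟨F.trans _ _ _ hu.1 hwv, h⟩ hu
    have habove : ∀ a ∈ A, F.lt a w := by
      intro a ha
      refine ⟨?_, fun h => hwA (h ▸ ha)⟩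
      rcases F.comparable _ _ v (hv a ha).1 hwv with h | h
      · exact h
      · exact absurd (hs.lower a ha w h) hwA
    have hs' : CopState F p (insert w A) (Function.update pos (p w) (Sum.inl w)) := by
      refine ⟨?_, ?_, ?_⟩
      · intro a ha u hu
        rcases Finset.mem_insert.1 ha with rfl | ha
        · by_cases h : u = a
          · simp [h]
          · exact Finset.mem_insert_of_mem (hbelow u ⟨hu, h⟩)
        · exact Finset.mem_insert_of_mem (hs.lower a ha u hu)
      · intro u hu h
        rcases Finset.mem_insert.1 hu with rfl | hu
        · simp
        · rw [Function.update_of_ne (h w (by simp) (habove u hu))]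
          exact hs.pos_eq u hu fun x hx => h x (Finset.mem_insert_of_mem hx)
      · intro j
        by_cases hj : j = p w
        · subst hj
          exact Or.inr ⟨w, by simp, rfl, by simp⟩
        · rw [Function.update_of_ne hj]
          rcases hs.pos_cases j with h | ⟨u, hu, h⟩
          · exact Or.inl h
          · exact Or.inr ⟨u, Finset.mem_insert_of_mem hu, h⟩
    -- As `w` carries no cop yet, exactly one cop changes place, as the rules require.
    have hwX : Sum.inl w ∉ Finset.univ.image pos := by
      simp only [Finset.mem_image, Finset.mem_univ, true_and, not_exists]
      intro j hj
      rcases hs.pos_cases j with h | ⟨u, hu, -, h⟩ <;> rw [hj] at h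
      · simp at h
      · exact hwA (by rwa [Sum.inl_injective h])
    have hinter : Finset.univ.image pos ∩
        Finset.univ.image (Function.update pos (p w) (Sum.inl w)) =
        (Finset.univ.erase (p w)).image pos := by
      ext x
      simp only [Finset.mem_inter, Finset.mem_image, Finset.mem_univ, true_and, Finset.mem_erase,
        and_true]
      constructor
      · rintro ⟨hx, j, hj⟩
        by_cases h : j = p w
        · subst h
          rw [Function.update_self] at hj
          subst hj
          exact absurd (by simpa using hx) hwX
        · exact ⟨j, h, by rwa [Function.update_of_ne h] at hj⟩
      · rintro ⟨j, h, hj⟩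
        exact ⟨⟨j, hj⟩, j, by rwa [Function.update_of_ne h]⟩
    have hk : 0 < k := (Nat.zero_le _).trans_lt (p w).isLt
    obtain ⟨v', hmove, hv', hsurv'⟩ := hsurv
      (Finset.univ.image (Function.update pos (p w) (Sum.inl w)))
      (by rw [Finset.card_image_of_injective _ hs'.injective]; simp)
      (by
        rw [hinter, Finset.card_image_of_injective _ hs.injective,
          Finset.card_erase_of_mem (Finset.mem_univ _)]
        simp only [Finset.card_univ, Fintype.card_fin]
        omega)
    have hwv' : F.le w v' := by
      refine hmove.mem_of_closed (S := {a | F.le w a}) hwv ?_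
      intro a (ha : F.le w a) b hab hb
      rcases hF.1 a b hab with h | h
      · exact F.trans _ _ _ ha h
      · rcases F.comparable w b a ha h with h' | h'
        · exact h'
        · by_cases hbw : b = w
          · exact hbw ▸ F.refl b
          · exfalso
            have hlt : F.lt b w := ⟨h', hbw⟩
            -- No vertex after `b` up to `a` has the pebble of `b`; this covers `w` and all later
            -- vertices of `A`, so the cop on `b` is neither moved now nor was moved before.
            have hp := hF.2 b a hab.symm (F.lt_of_lt_of_le hlt ha)
            apply hb
            rw [hinter]
            refine Finset.mem_image.2 ⟨p b, by simpa using hp w hlt ha, ?_⟩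
            exact hs.pos_eq b (hbelow b hlt) fun u hu hbu =>
              hp u hbu (F.trans _ _ _ (habove u hu).1 ha)
    have hne : w ≠ v' := by
      rintro rfl
      exact hv' (Finset.mem_image.2 ⟨p w, by simp⟩)
    refine ih _ _ v' hs' ?_ ?_ hsurv'
    · intro a ha
      rcases Finset.mem_insert.1 ha with rfl | ha
      · exact ⟨hwv', hne⟩
      · exact F.lt_of_lt_of_le (habove a ha) hwv'
    · rw [Finset.card_insert_of_notMem hwA]
      omega

theorem RobberWins.notMem_pebbleClass {V : Type} [Fintype V] [DecidableEq V] {G : SimpleGraph V}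
    {k q : ℕ} (h : RobberWins G k q) : FinGraph.of G ∉ PebbleClass k q := by
  rintro ⟨F, p, hF, hq⟩
  obtain ⟨v, hv⟩ := h
  refine CopState.not_robberSurvives hF hq q ∅ Sum.inr v ?_ (by simp) (by simp) ?_
  · exact ⟨by simp, by simp, fun j => Or.inl rfl⟩
  · rwa [Finset.map_eq_image] at hv

/-! ### From pebble forest covers to tree decompositions. -/

/-- The graph on `Option V` that joins each `v` to its parent `par v`, where `none` is the root. -/
def parentGraph {V : Type} (par : V → Option V) : SimpleGraph (Option V) :=
  SimpleGraph.fromRel fun x y => ∃ v, x = some v ∧ y = par v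

theorem parentGraph_adj {V : Type} {par : V → Option V} (hpar : ∀ v, par v ≠ some v) (v : V) :
    (parentGraph par).Adj (some v) (par v) := by
  rw [parentGraph, SimpleGraph.fromRel_adj]
  exact ⟨(hpar v).symm, Or.inl ⟨v, rfl, rfl⟩⟩

/-- Following parents leads to the root, so the graph is connected; it has one vertex more than `V`
and at most one edge per element of `V`. -/
theorem isTree_parentGraph {V : Type} [Finite V] {par : V → Option V} {r : V → V → Prop}
    (hr : WellFounded r) (hpar : ∀ v u, par v = some u → r u v) : (parentGraph par).IsTree := by
  have hne : ∀ v, par v ≠ some v := fun v h => hr.irrefl.irrefl v (hpar v v h)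
  have hconn : (parentGraph par).Connected := by
    rw [SimpleGraph.connected_iff_exists_forall_reachable]
    refine ⟨none, ?_⟩
    have key : ∀ v, (parentGraph par).Reachable none (some v) := by
      intro v
      induction v using hr.induction with
      | _ v ih =>
        have hadj := (parentGraph_adj hne v).symm.reachable
        cases h : par v with
        | none => rwa [h] at hadj
        | some u => rw [h] at hadj; exact (ih u (hpar v u h)).trans hadj
    intro x
    cases x with
    | none => exact SimpleGraph.Reachable.refl _
    | some v => exact key v
  rw [SimpleGraph.isTree_iff_connected_and_card]
  refine ⟨hconn, le_antisymm ?_ hconn.card_vert_le_card_edgeSet_add_one⟩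
  rw [Finite.card_option]
  have hsub : (parentGraph par).edgeSet ⊆ Set.range fun v => s(some v, par v) := by
    intro e he
    induction e using Sym2.ind with
    | _ x y =>
      rw [SimpleGraph.mem_edgeSet, parentGraph, SimpleGraph.fromRel_adj] at he
      rcases he.2 with ⟨v, rfl, rfl⟩ | ⟨v, rfl, rfl⟩
      · exact ⟨v, rfl⟩
      · exact ⟨v, Sym2.eq_swap⟩
  have h1 := Nat.card_mono (Set.toFinite _) hsub
  have h2 := Finite.card_range_le fun v : V => s(some v, par v)
  omega

theorem RootedForest.exists_parent {V : Type} [Finite V] (F : RootedForest V) :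
    ∃ par : V → Option V, ∀ v, (∀ u, par v = some u → F.lt u v) ∧
      ∀ u, F.lt u v → ∃ x, par v = some x ∧ F.le u x := by
  suffices H : ∀ v, ∃ o : Option V, (∀ u, o = some u → F.lt u v) ∧
      ∀ u, F.lt u v → ∃ x, o = some x ∧ F.le u x by
    choose par h using H
    exact ⟨par, h⟩
  intro v
  by_cases hv : ∃ u, F.lt u v
  · have : IsTrans V (flip F.lt) := ⟨fun _ _ _ h h' => F.lt_of_lt_of_le h' h.1⟩
    have : Std.Irrefl (flip F.lt) := ⟨fun _ h => h.2 rfl⟩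
    obtain ⟨x, hx, hmax⟩ :=
      (Finite.wellFounded_of_trans_of_irrefl (flip F.lt)).has_min {u | F.lt u v} hv
    refine ⟨some x, fun u hu => by cases hu; exact hx, fun u hu => ⟨x, rfl, ?_⟩⟩
    rcases F.comparable u x v hu.1 hx.1 with h | h
    · exact h
    · by_cases hux : x = u
      · exact hux ▸ F.refl x
      · exact absurd ⟨h, hux⟩ (hmax u hu)
  · exact ⟨none, by simp, fun u hu => absurd ⟨u, hu⟩ hv⟩

/-- Pebbles are distinct within a bag, so its size is at most `k`. If `u` lies in the bag at a
proper descendant `v`, it lies in the bag at the parent of `v`, so the nodes whose bags contain `u`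
are connected to `u`. The extra root `none`, with empty bag, joins the trees of the forest. -/
theorem IsPebbleForestCover.mem_TW {G : FinGraph} {k : ℕ} (hk : 1 ≤ k)
    {F : RootedForest G.verts} {p : G.verts → Fin k} (h : IsPebbleForestCover G.graph F p) :
    G ∈ TW (k - 1) := by
  classical
  obtain ⟨par, hpar⟩ := F.exists_parent
  have hne : ∀ v, par v ≠ some v := fun v hv => ((hpar v).1 v hv).2 rfl
  let P : G.verts → G.verts → Prop := fun u v =>
    F.le u v ∧ ∀ w, F.lt u w → F.le w v → p u ≠ p w
  let bag : Option G.verts → Finset G.verts := fun o =>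
    o.elim ∅ fun v => Finset.univ.filter fun u => P u v
  have hbag : ∀ u v, u ∈ bag (some v) ↔ P u v := fun u v => by simp [bag]
  have hbag0 : ∀ u, u ∉ bag none := fun u => by simp [bag]
  have hself : ∀ v, P v v := fun v =>
    ⟨F.refl v, fun w h1 h2 => absurd (F.antisymm _ _ h1.1 h2) h1.2⟩
  have hedge : ∀ u v, G.graph.Adj u v → F.le u v → ∃ t, u ∈ bag t ∧ v ∈ bag t := by
    intro u v huv hle
    exact ⟨some v, (hbag _ _).2 ⟨hle, h.2 u v huv ⟨hle, huv.ne⟩⟩, (hbag _ _).2 (hself v)⟩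
  refine ⟨{
    node := Option G.verts
    tree := parentGraph par
    isTree := isTree_parentGraph F.wellFounded_lt fun v => (hpar v).1
    bag := bag
    exists_mem_bag := fun v => ⟨some v, (hbag _ _).2 (hself v)⟩
    exists_adj_mem_bag := ?_
    connected := ?_ }, ?_⟩
  · intro u v huv
    rcases h.1 u v huv with hle | hle
    · exact hedge u v huv hle
    · obtain ⟨t, h1, h2⟩ := hedge v u huv.symm hle
      exact ⟨t, h2, h1⟩
  · intro u
    rw [SimpleGraph.connected_iff_exists_forall_reachable]
    refine ⟨⟨some u, (hbag _ _).2 (hself u)⟩, ?_⟩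
    have key : ∀ v (hv : u ∈ bag (some v)),
        ((parentGraph par).induce {t | u ∈ bag t}).Reachable
          ⟨some u, (hbag _ _).2 (hself u)⟩ ⟨some v, hv⟩ := by
      intro v
      induction v using F.wellFounded_lt.induction with
      | _ v ih =>
        intro hv
        have hP := (hbag _ _).1 hv
        by_cases huv : u = v
        · subst huv; exact SimpleGraph.Reachable.refl _
        · obtain ⟨x, hx, hux⟩ := (hpar v).2 u ⟨hP.1, huv⟩
          have hxv := (hpar v).1 x hx
          have hxb : u ∈ bag (some x) :=
            (hbag _ _).2 ⟨hux, fun w h1 h2 => hP.2 w h1 (F.trans _ _ _ h2 hxv.1)⟩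
          refine (ih x hxv hxb).trans (SimpleGraph.Adj.reachable ?_)
          have := parentGraph_adj hne v
          rw [hx] at this
          exact this.symm
    rintro ⟨_ | v, hv⟩
    · exact absurd hv (hbag0 u)
    · exact key v hv
  · have hcard : ∀ t, (bag t).card ≤ k := by
      rintro (_ | v)
      · simp [bag]
      · have hinj : Set.InjOn p (bag (some v) : Set G.verts) := by
          intro a ha b hb hab
          have ha := (hbag _ _).1 ha
          have hb := (hbag _ _).1 hb
          by_contra hne
          rcases F.comparable a b v ha.1 hb.1 with hle | hle
          · exact ha.2 b ⟨hle, hne⟩ hb.1 hab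
          · exact hb.2 a ⟨hle, Ne.symm hne⟩ ha.1 hab.symm
        simpa using Finset.card_le_card_of_injOn p (fun _ _ => Finset.mem_univ _) hinj
    have hsup : (Finset.univ.sup fun t => (bag t).card) ≤ k := Finset.sup_le fun t _ => hcard t
    unfold TreeDecomposition.width
    dsimp only
    have : ((Finset.univ.sup fun t => (bag t).card : ℕ) : ℤ) ≤ k := by exact_mod_cast hsup
    push_cast [hk]
    linarith

theorem pebbleClass_subset {k : ℕ} (hk : 1 ≤ k) (q : ℕ) :
    PebbleClass k q ⊆ TW (k - 1) ∩ TD q := by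
  rintro G ⟨F, p, h, hq⟩
  exact ⟨h.mem_TW hk, F, h.1, hq⟩

/-- A graph of bandwidth less than `k` has treewidth less than `k`. -/
theorem mem_TW_of_bandwidth {V : Type} [Fintype V] {G : SimpleGraph V} {k : ℕ} (hk : 1 ≤ k)
    {f : V → ℕ} (hf : Function.Injective f) (hG : ∀ u v, G.Adj u v → f v < f u + k) :
    FinGraph.of G ∈ TW (k - 1) := by
  let F : RootedForest V :=
    { le := fun u v => f u ≤ f v
      refl := fun v => le_rfl
      antisymm := fun u v h h' => hf (le_antisymm h h')
      trans := fun u v w h h' => h.trans h'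
      comparable := fun u u' v _ _ => le_total _ _ }
  -- On the linear order given by `f`, pebbles modulo `k` work: equal residues are at least `k`
  -- apart, farther than any edge reaches.
  refine IsPebbleForestCover.mem_TW (G := FinGraph.of G) hk (F := F)
    (p := fun v => ⟨f v % k, Nat.mod_lt _ hk⟩) ⟨fun u v _ => le_total _ _, ?_⟩
  intro u v huv _ w huw hwv heq
  have h1 := hG u v huv
  have h2 : f u < f w := lt_of_le_of_ne huw.1 fun h => huw.2 (hf h)
  have h3 : f w ≤ f v := hwv
  have h4 : f u % k = f w % k := congrArg Fin.val heq
  have h5 := (Nat.modEq_iff_dvd' h2.le).1 h4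
  have := Nat.le_of_dvd (by omega) h5
  omega

/-! ### Dyadic forest covers and treedepth. -/

theorem exists_eq_two_pow_padicValNat_mul {z : ℕ} (hz : z ≠ 0) :
    ∃ t, z = 2 ^ padicValNat 2 z * (2 * t + 1) := by
  obtain ⟨n, hn⟩ := pow_padicValNat_dvd (p := 2) (n := z)
  have hodd : ¬ 2 ∣ n := by
    rintro ⟨m, rfl⟩
    refine pow_succ_padicValNat_not_dvd (p := 2) hz ⟨m, ?_⟩
    rw [pow_succ, mul_assoc, ← hn]
  refine ⟨n / 2, ?_⟩
  have h : 2 * (n / 2) + 1 = n := by omega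
  rwa [h]

/-- If `z = 2 ^ e * (2 * t + 1)`, then `t = z / 2 ^ (e + 1)`, so the valuation and this quotient
determine `z`: each dyadic block has only one centre. -/
theorem eq_of_div_two_pow_eq {x y : ℕ} (hx : x ≠ 0) (hy : y ≠ 0)
    (hv : padicValNat 2 x = padicValNat 2 y)
    (h : x / 2 ^ (padicValNat 2 x + 1) = y / 2 ^ (padicValNat 2 x + 1)) : x = y := by
  obtain ⟨s, hs⟩ := exists_eq_two_pow_padicValNat_mul hx
  obtain ⟨t, ht⟩ := exists_eq_two_pow_padicValNat_mul hy
  rw [← hv] at ht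
  have key : ∀ z u, z = 2 ^ padicValNat 2 x * (2 * u + 1) →
      z / 2 ^ (padicValNat 2 x + 1) = u := by
    intro z u hz
    rw [pow_succ, ← Nat.div_div_eq_div_mul, hz, Nat.mul_div_cancel_left _ (by positivity)]
    omega
  rw [key x s hs, key y t ht] at h
  rw [hs, ht, h]

theorem div_two_pow_eq_of_le {x y i j : ℕ} (h : x / 2 ^ i = y / 2 ^ i) (hij : i ≤ j) :
    x / 2 ^ j = y / 2 ^ j := by
  obtain ⟨d, rfl⟩ := Nat.exists_eq_add_of_le hij
  rw [pow_add, ← Nat.div_div_eq_div_mul, ← Nat.div_div_eq_div_mul, h]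

/-- Of two consecutive positive numbers, the one with the smaller `2`-adic valuation lies in the
dyadic block centred at the other. -/
theorem div_two_pow_eq_of_consecutive {x y : ℕ} (hx : x ≠ 0) (hy : y ≠ 0)
    (hxy : x = y + 1 ∨ y = x + 1) (hv : padicValNat 2 x ≤ padicValNat 2 y) :
    padicValNat 2 x < padicValNat 2 y ∧
      x / 2 ^ (padicValNat 2 y + 1) = y / 2 ^ (padicValNat 2 y + 1) := by
  obtain ⟨s, hs⟩ := exists_eq_two_pow_padicValNat_mul hx
  obtain ⟨t, ht⟩ := exists_eq_two_pow_padicValNat_mul hy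
  generalize padicValNat 2 x = d at *
  generalize padicValNat 2 y = e at *
  cases e with
  | zero =>
    obtain rfl : d = 0 := by omega
    simp only [pow_zero, one_mul] at hs ht
    omega
  | succ e =>
    have hp : 0 < 2 ^ e := by positivity
    have hy2 : y = 4 * (2 ^ e * t) + 2 * 2 ^ e := by rw [ht]; ring
    constructor
    · cases d with
      | zero => omega
      | succ d =>
        have hx2 : x = 2 * (2 ^ d * (2 * s + 1)) := by rw [hs]; ring
        omega
    · have hq : 2 ^ (e + 1 + 1) = 4 * 2 ^ e := by ring
      have ht4 : t * (4 * 2 ^ e) = 4 * (2 ^ e * t) := by ring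
      have hyd : y / 2 ^ (e + 1 + 1) = t := by
        rw [Nat.div_eq_iff (by positivity), hq]
        omega
      rw [hyd, Nat.div_eq_iff (by positivity), hq]
      omega

/-- Columns are arranged as in a binary search tree, the one with the highest `2`-adic valuation on
top, and each node is expanded to a chain of at most `h` vertices. The level `L` strictly decreases
from ancestor to descendant and takes values below `h * m`, which bounds the height. -/
theorem mem_TD_of_layers {V : Type} [Fintype V] {G : SimpleGraph V} {h m : ℕ}
    (c r : V → ℕ) (hc : ∀ v, c v ≠ 0 ∧ c v < 2 ^ m) (hr : ∀ v, r v < h)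
    (hinj : ∀ u v, c u = c v → r u = r v → u = v)
    (hG : ∀ u v, G.Adj u v → c u = c v ∨ c u = c v + 1 ∨ c v = c u + 1) :
    FinGraph.of G ∈ TD (h * m) := by
  let val : V → ℕ := fun v => padicValNat 2 (c v)
  let L : V → ℕ := fun v => h * val v + r v
  have hLval : ∀ u v, L u ≤ L v → val u ≤ val v := by
    intro u v huv
    by_contra hlt
    have h1 : h * (val v + 1) ≤ h * val u := Nat.mul_le_mul_left h (by omega)
    have h2 := hr v
    simp only [L] at huv
    rw [mul_add] at h1
    omega
  have hLlt : ∀ u v, val u < val v → L u ≤ L v := by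
    intro u v huv
    have h1 : h * (val u + 1) ≤ h * val v := Nat.mul_le_mul_left h (by omega)
    have h2 := hr u
    simp only [L]
    rw [mul_add] at h1
    omega
  -- The column of a descendant lies in the dyadic block centred at the column of its ancestor.
  let le : V → V → Prop := fun u v =>
    L v ≤ L u ∧ c v / 2 ^ (val u + 1) = c u / 2 ^ (val u + 1)
  have heq : ∀ u v, le u v → L u = L v → u = v := by
    intro u v huv hL
    have hv : val u = val v := le_antisymm (hLval _ _ hL.le) (hLval _ _ hL.ge)
    refine hinj u v (eq_of_div_two_pow_eq (hc u).1 (hc v).1 hv huv.2.symm) ?_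
    simp only [L, hv] at hL
    omega
  have hcomp : ∀ u u' v, le u v → le u' v → L u' ≤ L u → le u u' := by
    intro u u' v h1 h2 hL
    refine ⟨hL, ?_⟩
    have := div_two_pow_eq_of_le h2.2 (Nat.add_le_add_right (hLval _ _ hL) 1)
    rw [← this, h1.2]
  let F : RootedForest V :=
    { le := le
      refl := fun v => ⟨le_rfl, rfl⟩
      antisymm := fun u v h1 h2 => heq u v h1 (le_antisymm h2.1 h1.1)
      trans := fun u v w h1 h2 => ⟨h2.1.trans h1.1, by
        have := div_two_pow_eq_of_le h2.2 (Nat.add_le_add_right (hLval _ _ h1.1) 1)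
        rw [this, h1.2]⟩
      comparable := fun u u' v h1 h2 =>
        (le_total (L u') (L u)).imp (hcomp u u' v h1 h2) (hcomp u' u v h2 h1) }
  refine ⟨F, ?_, ?_⟩
  · suffices H : ∀ u v, G.Adj u v → val v ≤ val u → F.le u v ∨ F.le v u by
      intro u v huv
      rcases le_total (val v) (val u) with hle | hle
      · exact H u v huv hle
      · exact (H v u huv.symm hle).symm
    intro u v huv hle
    by_cases hcc : c u = c v
    · have hval : val u = val v := by simp only [val, hcc]
      rcases le_total (L v) (L u) with hL | hL
      · exact Or.inl ⟨hL, by rw [hcc]⟩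
      · exact Or.inr ⟨hL, by rw [hcc]⟩
    · obtain ⟨h1, h2⟩ := div_two_pow_eq_of_consecutive (x := c v) (y := c u) (hc v).1 (hc u).1
        (by have := hG u v huv; omega) hle
      exact Or.inl ⟨hLlt _ _ h1, h2⟩
  · rw [RootedForest.height_le_iff]
    intro s hs
    have hL : ∀ v, L v < h * m := by
      intro v
      have h1 : 2 ^ val v ≤ c v := Nat.le_of_dvd (Nat.pos_of_ne_zero (hc v).1) pow_padicValNat_dvd
      have h2 : val v < m := (Nat.pow_lt_pow_iff_right (by norm_num : 1 < 2)).1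
        (h1.trans_lt (hc v).2)
      have h3 : h * (val v + 1) ≤ h * m := Nat.mul_le_mul_left h (by omega)
      have h4 := hr v
      simp only [L]
      rw [mul_add] at h3
      omega
    have := Finset.card_le_card_of_injOn (s := s) (t := Finset.range (h * m)) L
      (fun v _ => by simpa using hL v) (by
        intro u hu v hv huv
        by_contra hne
        rcases hs hu hv hne with h1 | h1
        · exact hne (heq u v h1 huv)
        · exact hne (heq v u h1 huv.symm).symm)
    simpa using this

/-! ### Robber's paths. -/

/-- `v'` can be reached from `v` in `G` without visiting `Y` (unless `v = v'`). -/
def ReachAvoiding {V : Type} {k : ℕ} (G : SimpleGraph V) (Y : Finset (V ⊕ Fin k)) : V → V → Prop :=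
  Relation.ReflTransGen fun a b => G.Adj a b ∧ Sum.inl a ∉ Y ∧ Sum.inl b ∉ Y

theorem ReachAvoiding.symm {V : Type} {k : ℕ} {G : SimpleGraph V} {Y : Finset (V ⊕ Fin k)}
    {v v' : V} (h : ReachAvoiding G Y v v') : ReachAvoiding G Y v' v := by
  have : Std.Symm fun a b => G.Adj a b ∧ Sum.inl a ∉ Y ∧ Sum.inl b ∉ Y :=
    ⟨fun _ _ h => ⟨h.1.symm, h.2.2, h.2.1⟩⟩
  exact Std.Symm.symm (r := Relation.ReflTransGen _) _ _ h

theorem ReachAvoiding.robberMove {V : Type} {k : ℕ} {G : SimpleGraph V} {Y : Finset (V ⊕ Fin k)}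
    {v v' : V} (h : ReachAvoiding G Y v v') (hv : Sum.inl v ∉ Y) : RobberMove G k Y v v' := by
  classical
  suffices H : ∃ P : (board G k).Walk (Sum.inl v) (Sum.inl v'), ∀ x ∈ P.support, x ∉ Y by
    obtain ⟨P, hP⟩ := H
    exact ⟨P.bypass, P.bypass_isPath, fun x hx => hP x (P.support_bypass_subset_support hx)⟩
  induction h with
  | refl => exact ⟨SimpleGraph.Walk.nil, by simpa using hv⟩
  | @tail b c _ hbc ih =>
    obtain ⟨P, hP⟩ := ih
    refine ⟨P.concat (by simpa using hbc.1), fun x hx => ?_⟩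
    rw [SimpleGraph.Walk.support_concat] at hx
    have hx : x ∈ P.support ∨ x = Sum.inl c := by simpa using hx
    rcases hx with hx | rfl
    · exact hP x hx
    · exact hbc.2.2

theorem reachAvoiding_of_interval {V : Type} {k N : ℕ} {G : SimpleGraph V}
    {Y : Finset (V ⊕ Fin k)} (φ : Fin N → V)
    (hφ : ∀ a b, (SimpleGraph.pathGraph N).Adj a b → G.Adj (φ a) (φ b)) (a b : Fin N)
    (h : ∀ x, min a b ≤ x → x ≤ max a b → Sum.inl (φ x) ∉ Y) :
    ReachAvoiding G Y (φ a) (φ b) := by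
  suffices H : ∀ (a : Fin N) (n : ℕ), a.val ≤ n → ∀ hn : n < N,
      (∀ x : Fin N, a.val ≤ x.val → x.val ≤ n → Sum.inl (φ x) ∉ Y) →
      ReachAvoiding G Y (φ a) (φ ⟨n, hn⟩) by
    rcases le_total a b with hab | hab
    · rw [min_eq_left hab, max_eq_right hab] at h
      exact H a b hab b.isLt fun x h1 h2 => h x h1 h2
    · rw [min_eq_right hab, max_eq_left hab] at h
      exact (H b a hab a.isLt fun x h1 h2 => h x h1 h2).symm
  intro a n han
  induction n, han using Nat.le_induction with
  | base => exact fun _ _ => Relation.ReflTransGen.refl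
  | succ n han ih =>
    intro hn hfree
    refine (ih (by omega) fun x h1 h2 => hfree x h1 (by omega)).tail ⟨?_, ?_, ?_⟩
    · exact hφ _ _ (SimpleGraph.pathGraph_adj.2 (Or.inl rfl))
    · exact hfree _ han (by simp)
    · exact hfree _ (by simp; omega) (by simp)

/-! ### Robber's strategy on a grid -/

section Grid

variable {h l k : ℕ}

/-- No cop stands in the column `j`. -/
def ColFree (X : Finset ((Fin h × Fin l) ⊕ Fin k)) (j : Fin l) : Prop :=
  ∀ i, Sum.inl (i, j) ∉ X

/-- Cops at `(i, c i)`, one in each row, which block the passage between left and right. -/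
structure IsBarrier (X : Finset ((Fin h × Fin l) ⊕ Fin k)) (c : Fin h → Fin l) : Prop where
  mem : ∀ i, Sum.inl (i, c i) ∈ X
  close : ∀ i j : Fin h, i.val + 1 = j.val →
    (c i).val ≤ (c j).val + 1 ∧ (c j).val ≤ (c i).val + 1

theorem IsBarrier.mono {X X' : Finset ((Fin h × Fin l) ⊕ Fin k)} {c : Fin h → Fin l}
    (hc : IsBarrier X c) (hX : X ⊆ X') : IsBarrier X' c :=
  ⟨fun i => hX (hc.mem i), hc.close⟩

theorem IsBarrier.le_add {X : Finset ((Fin h × Fin l) ⊕ Fin k)} {c : Fin h → Fin l}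
    (hc : IsBarrier X c) (i j : Fin h) : (c i).val + 1 ≤ (c j).val + h := by
  have key : ∀ (i : Fin h) (n : ℕ), i.val ≤ n → ∀ hn : n < h,
      (c i).val + i.val ≤ (c ⟨n, hn⟩).val + n ∧ (c ⟨n, hn⟩).val + i.val ≤ (c i).val + n := by
    intro i n hin
    induction n, hin using Nat.le_induction with
    | base => exact fun _ => ⟨le_rfl, le_rfl⟩
    | succ n hin ih =>
      intro hn
      have h1 := ih (by omega)
      have h2 := hc.close ⟨n, by omega⟩ ⟨n + 1, hn⟩ rfl
      omega
  rcases le_total i j with hij | hij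
  · have := key i j hij j.isLt
    simp only [Fin.eta] at this
    omega
  · have := key j i hij i.isLt
    simp only [Fin.eta] at this
    omega

/-- Used contrapositively: among `h + 1` cops that include one per row at `c`, at most one stands
off `c`. -/
theorem add_two_le_card {X : Finset ((Fin h × Fin l) ⊕ Fin k)} {c : Fin h → Fin l}
    (hc : ∀ i, Sum.inl (i, c i) ∈ X) {a b : Fin h} {x y : Fin l} (hne : (a, x) ≠ (b, y))
    (ha : Sum.inl (a, x) ∈ X) (hb : Sum.inl (b, y) ∈ X) (hxa : x ≠ c a) (hyb : y ≠ c b) :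
    h + 2 ≤ X.card := by
  classical
  let S : Finset ((Fin h × Fin l) ⊕ Fin k) := Finset.univ.image fun i => Sum.inl (i, c i)
  have hS : S.card = h := by
    rw [Finset.card_image_of_injective, Finset.card_univ, Fintype.card_fin]
    intro i j hij
    simp only [Sum.inl.injEq, Prod.mk.injEq] at hij
    exact hij.1
  have hmem : ∀ (a : Fin h) (x : Fin l), x ≠ c a → Sum.inl (a, x) ∉ S := by
    intro a x hx hS
    obtain ⟨i, -, hi⟩ := Finset.mem_image.1 hS
    simp only [Sum.inl.injEq, Prod.mk.injEq] at hi
    exact hx (by rw [← hi.2, hi.1])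
  have h1 : (insert (Sum.inl (a, x)) (insert (Sum.inl (b, y)) S)).card = h + 2 := by
    rw [Finset.card_insert_of_notMem, Finset.card_insert_of_notMem (hmem b y hyb), hS]
    intro hin
    rcases Finset.mem_insert.1 hin with heq | hin
    · exact hne (Sum.inl_injective heq)
    · exact hmem a x hxa hin
  rw [← h1]
  refine Finset.card_le_card ?_
  intro z hz
  simp only [Finset.mem_insert] at hz
  rcases hz with rfl | rfl | hz
  · exact ha
  · exact hb
  · obtain ⟨i, -, rfl⟩ := Finset.mem_image.1 hz
    exact hc i

/-- Two barriers formed by the same `h + 1` cops are close to each other. -/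
theorem IsBarrier.exists_close {X : Finset ((Fin h × Fin l) ⊕ Fin k)} (hh : 2 ≤ h)
    (hX : X.card ≤ h + 1) {c c' : Fin h → Fin l} (hc : IsBarrier X c) (hc' : IsBarrier X c')
    (i : Fin h) : ∃ i', (c' i).val ≤ (c i').val + 1 ∧ (c i').val ≤ (c' i).val + 1 := by
  by_cases hi : c' i = c i
  · exact ⟨i, by rw [hi]; omega⟩
  · obtain ⟨i', hi'⟩ : ∃ i' : Fin h, i'.val + 1 = i.val ∨ i.val + 1 = i'.val := by
      by_cases h0 : i.val = 0
      · exact ⟨⟨1, by omega⟩, Or.inr (by simp [h0])⟩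
      · exact ⟨⟨i.val - 1, by omega⟩, Or.inl (by simp; omega)⟩
    -- Differing in both rows `i` and `i'` would take `h + 2` cops. So the barriers agree in row
    -- `i'`, and `c' i` is within one column of that common entry.
    have heq : c' i' = c i' := by
      by_contra hne
      have := add_two_le_card hc.mem (a := i) (b := i') (x := c' i) (y := c' i')
        (by intro heq; simp only [Prod.mk.injEq] at heq; rw [← heq.1] at hi'; omega)
        (hc'.mem i) (hc'.mem i') hi hne
      omega
    refine ⟨i', ?_⟩
    rw [← heq]
    rcases hi' with hi' | hi'
    · exact (hc'.close i' i hi').symm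
    · exact hc'.close i i' hi'

theorem exists_colFree_of_barrier {X : Finset ((Fin h × Fin l) ⊕ Fin k)} (hX : X.card ≤ h + 1)
    {c : Fin h → Fin l} (hc : IsBarrier X c) {x y : Fin l} (hxy : x ≠ y) (hx : ∀ i, x ≠ c i)
    (hy : ∀ i, y ≠ c i) : ColFree X x ∨ ColFree X y := by
  by_contra hcon
  simp only [ColFree, not_or, not_forall, not_not] at hcon
  obtain ⟨⟨a, ha⟩, b, hb⟩ := hcon
  have := add_two_le_card hc.mem (a := a) (b := b) (by simp [hxy]) ha hb (hx a) (hy b)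
  omega

theorem exists_colFree {X : Finset ((Fin h × Fin l) ⊕ Fin k)} (hX : X.card < l) :
    ∃ j, ColFree X j := by
  by_contra hcon
  simp only [ColFree, not_exists, not_forall, not_not] at hcon
  choose r hr using hcon
  have := Finset.card_le_card_of_injOn (s := Finset.univ) (t := X)
    (fun j : Fin l => Sum.inl (r j, j)) (fun j _ => hr j) (by
      intro i _ j _ hij
      simp only [Sum.inl.injEq, Prod.mk.injEq] at hij
      exact hij.2)
  simp only [Finset.card_univ, Fintype.card_fin] at this
  omega

theorem reachAvoiding_row {Y : Finset ((Fin h × Fin l) ⊕ Fin k)} (i : Fin h) (a b : Fin l)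
    (hY : ∀ x, min a b ≤ x → x ≤ max a b → Sum.inl (i, x) ∉ Y) :
    ReachAvoiding (grid h l) Y (i, a) (i, b) :=
  reachAvoiding_of_interval (fun x => (i, x)) (fun _ _ hab => by simpa using hab) a b hY

theorem ColFree.reachAvoiding {Y : Finset ((Fin h × Fin l) ⊕ Fin k)} {j : Fin l}
    (hj : ColFree Y j) (a b : Fin h) : ReachAvoiding (grid h l) Y (a, j) (b, j) :=
  reachAvoiding_of_interval (fun x => (x, j)) (fun _ _ hab => by simpa using hab) a b
    fun x _ _ => hj x

/-- The meeting point is in row `i`, just right of its cop. Columns right of that cop reach it along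
row `i`; the others go along row `j`, left of the cop there, and cross over from row `j` in column
`m`. -/
theorem exists_reachAvoiding_of_gap {Y : Finset ((Fin h × Fin l) ⊕ Fin k)} {c : Fin h → Fin l}
    (hY : ∀ i x, Sum.inl (i, x) ∈ Y → x = c i) {i j : Fin h}
    (hij : (SimpleGraph.pathGraph h).Adj i j) (hgap : (c i).val + 1 < (c j).val) :
    ∃ t, ∀ a x, ColFree Y x → ReachAvoiding (grid h l) Y (a, x) t := by
  have hm : (c i).val + 1 < l := hgap.trans (c j).isLt
  let m : Fin l := ⟨(c i).val + 1, hm⟩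
  have hmv : m.val = (c i).val + 1 := rfl
  have hrow : ∀ (i : Fin h) (y z : Fin l), ((c i).val < y.val ∧ (c i).val < z.val) ∨
      (y.val < (c i).val ∧ z.val < (c i).val) → ReachAvoiding (grid h l) Y (i, y) (i, z) := by
    intro i y z hyz
    refine reachAvoiding_row i y z fun x h1 h2 hx => ?_
    have hx' : x.val = (c i).val := congrArg Fin.val (hY i x hx)
    simp only [min_le_iff, le_max_iff, Fin.le_def] at h1 h2
    omega
  refine ⟨(i, m), fun a x hx => ?_⟩
  by_cases hxi : (c i).val < x.val
  · exact (hx.reachAvoiding a i).trans (hrow i x m (by omega))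
  · refine ((hx.reachAvoiding a j).trans (hrow j x m (by omega))).tail ⟨?_, ?_, ?_⟩
    · simpa using hij.symm
    · intro hmem
      have := congrArg Fin.val (hY _ _ hmem)
      omega
    · intro hmem
      have := congrArg Fin.val (hY _ _ hmem)
      omega

/-- Without a barrier, `h` cops do not separate the columns they leave free. -/
theorem reachAvoiding_of_not_isBarrier {Y : Finset ((Fin h × Fin l) ⊕ Fin k)} (hY : Y.card ≤ h)
    (hbar : ∀ c, ¬ IsBarrier Y c) {a b : Fin h} {x y : Fin l} (hx : ColFree Y x)
    (hy : ColFree Y y) : ReachAvoiding (grid h l) Y (a, x) (b, y) := by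
  classical
  suffices H : ∃ t, ∀ a x, ColFree Y x → ReachAvoiding (grid h l) Y (a, x) t by
    obtain ⟨t, ht⟩ := H
    exact (ht a x hx).trans (ht b y hy).symm
  -- A row without cops connects all free columns. Otherwise the at most `h` cops stand one per row,
  -- and the absence of a barrier gives a gap between neighbouring rows.
  by_cases hrow : ∃ i, ∀ z, Sum.inl (i, z) ∉ Y
  · obtain ⟨i, hi⟩ := hrow
    exact ⟨(i, x), fun a z hz =>
      (hz.reachAvoiding a i).trans (reachAvoiding_row i z x fun w _ _ => hi w)⟩
  · simp only [not_exists, not_forall, not_not] at hrow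
    choose c hc using hrow
    have hS : (Finset.univ.image fun i => (Sum.inl (i, c i) : (Fin h × Fin l) ⊕ Fin k)) = Y := by
      refine Finset.eq_of_subset_of_card_le ?_ ?_
      · intro z hz
        obtain ⟨i, -, rfl⟩ := Finset.mem_image.1 hz
        exact hc i
      · rw [Finset.card_image_of_injective, Finset.card_univ, Fintype.card_fin]
        · exact hY
        · intro i j hij
          simp only [Sum.inl.injEq, Prod.mk.injEq] at hij
          exact hij.1
    have huniq : ∀ i z, Sum.inl (i, z) ∈ Y → z = c i := by
      intro i z hz
      rw [← hS] at hz
      obtain ⟨i', -, hi'⟩ := Finset.mem_image.1 hz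
      simp only [Sum.inl.injEq, Prod.mk.injEq] at hi'
      rw [← hi'.2, hi'.1]
    have hnot : ∃ i j : Fin h, i.val + 1 = j.val ∧
        ¬ ((c i).val ≤ (c j).val + 1 ∧ (c j).val ≤ (c i).val + 1) := by
      by_contra hcon
      refine hbar c ⟨hc, fun i j hij => ?_⟩
      by_contra hcl
      exact hcon ⟨i, j, hij, hcl⟩
    obtain ⟨i, j, hij, hcl⟩ := hnot
    by_cases hlt : (c i).val + 1 < (c j).val
    · exact exists_reachAvoiding_of_gap huniq (SimpleGraph.pathGraph_adj.2 (Or.inl hij)) hlt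
    · exact exists_reachAvoiding_of_gap huniq (SimpleGraph.pathGraph_adj.2 (Or.inr hij))
        (by omega)

/-- The column `j` is safe for Robber for `n` further rounds: it is free, and if there is a barrier,
then it is at the border of the grid and the barrier is still far from that border. -/
def IsSafe (n : ℕ) (X : Finset ((Fin h × Fin l) ⊕ Fin k)) (j : Fin l) : Prop :=
  ColFree X j ∧ ∀ c, IsBarrier X c →
    (j.val ≤ 1 ∧ ∀ i, n + 2 ≤ (c i).val) ∨ (l ≤ j.val + 2 ∧ ∀ i, (c i).val + n + 3 ≤ l)

/-- Only one cop is off the barrier, so column `0` or column `1` is free. Any other barrier in `X`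
is at most one column nearer, whence `n + 3` drops to `n + 2`. -/
theorem exists_isSafe_left {n : ℕ} {X : Finset ((Fin h × Fin l) ⊕ Fin k)} (hh : 2 ≤ h)
    (hX : X.card ≤ h + 1) {c : Fin h → Fin l} (hc : IsBarrier X c)
    (hn : ∀ i, n + 3 ≤ (c i).val) : ∃ j, IsSafe n X j ∧ j.val ≤ 1 := by
  have hl : n + 3 < l := (hn ⟨0, by omega⟩).trans_lt (c _).isLt
  have hfree := exists_colFree_of_barrier hX hc (x := ⟨0, by omega⟩) (y := ⟨1, by omega⟩)
    (by simp) (fun i hi => by have := hn i; rw [← hi] at this; simp at this)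
    (fun i hi => by have := hn i; rw [← hi] at this; simp at this)
  have hbar : ∀ c', IsBarrier X c' → ∀ i, n + 2 ≤ (c' i).val := by
    intro c' hc' i
    obtain ⟨i', h1, h2⟩ := hc.exists_close hh hX hc' i
    have := hn i'
    omega
  rcases hfree with hf | hf
  · exact ⟨_, ⟨hf, fun c' hc' => Or.inl ⟨by simp, hbar c' hc'⟩⟩, by simp⟩
  · exact ⟨_, ⟨hf, fun c' hc' => Or.inl ⟨by simp, hbar c' hc'⟩⟩, by simp⟩

theorem exists_isSafe_right {n : ℕ} {X : Finset ((Fin h × Fin l) ⊕ Fin k)} (hh : 2 ≤ h)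
    (hX : X.card ≤ h + 1) {c : Fin h → Fin l} (hc : IsBarrier X c)
    (hn : ∀ i, (c i).val + n + 4 ≤ l) : ∃ j, IsSafe n X j ∧ l ≤ j.val + 2 := by
  have hl : n + 4 ≤ l := by have := hn ⟨0, by omega⟩; omega
  have hfree := exists_colFree_of_barrier hX hc (x := ⟨l - 1, by omega⟩) (y := ⟨l - 2, by omega⟩)
    (by simp; omega) (fun i hi => by have := hn i; rw [← hi] at this; simp at this; omega)
    (fun i hi => by have := hn i; rw [← hi] at this; simp at this; omega)
  have hbar : ∀ c', IsBarrier X c' → ∀ i, (c' i).val + n + 3 ≤ l := by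
    intro c' hc' i
    obtain ⟨i', h1, h2⟩ := hc.exists_close hh hX hc' i
    have := hn i'
    omega
  rcases hfree with hf | hf
  · exact ⟨_, ⟨hf, fun c' hc' => Or.inr ⟨by simp; omega, hbar c' hc'⟩⟩, by simp; omega⟩
  · exact ⟨_, ⟨hf, fun c' hc' => Or.inr ⟨by simp; omega, hbar c' hc'⟩⟩, by simp; omega⟩

theorem exists_isSafe {n : ℕ} {X : Finset ((Fin h × Fin l) ⊕ Fin k)} (hh : 2 ≤ h)
    (hl : 2 * n + h + 5 ≤ l) (hX : X.card ≤ h + 1) : ∃ j, IsSafe n X j := by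
  by_cases hbar : ∃ c, IsBarrier X c
  · obtain ⟨c, hc⟩ := hbar
    by_cases hn : ∀ i, n + 3 ≤ (c i).val
    · obtain ⟨j, hj, -⟩ := exists_isSafe_left hh hX hc hn
      exact ⟨j, hj⟩
    · simp only [not_forall, not_le] at hn
      obtain ⟨i, hi⟩ := hn
      -- A barrier spans at most `h` columns, so one with an entry at most `n + 2` stays within `n +
      -- h + 1`; the bound on `l` then leaves enough room on the right.
      obtain ⟨j, hj, -⟩ := exists_isSafe_right (n := n) hh hX hc fun i' => by
        have := hc.le_add i' i
        omega
      exact ⟨j, hj⟩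
  · obtain ⟨j, hj⟩ := exists_colFree (X := X) (by omega)
    exact ⟨j, hj, fun c hc => absurd ⟨c, hc⟩ hbar⟩

/-- Only the cops in `X ∩ X'` obstruct the move. If they form a barrier, it was already one in `X`,
so Robber is at a border far from it and shifts by at most one column. If not, every free column is
reachable and any safe one will do. -/
theorem IsSafe.exists_next {n : ℕ} {X X' : Finset ((Fin h × Fin l) ⊕ Fin k)} {i : Fin h}
    {j : Fin l} (hh : 2 ≤ h) (hl : 2 * n + h + 5 ≤ l) (hj : IsSafe (n + 1) X j)
    (hX' : X'.card ≤ h + 1) (hXX' : (X ∩ X').card ≤ h) :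
    ∃ j', IsSafe n X' j' ∧ ReachAvoiding (grid h l) (X ∩ X') (i, j) (i, j') := by
  have hfree : ColFree (X ∩ X') j := fun i hi => hj.1 i (Finset.mem_inter.1 hi).1
  have hfree' : ∀ j', IsSafe n X' j' → ColFree (X ∩ X') j' :=
    fun j' hj' i hi => hj'.1 i (Finset.mem_inter.1 hi).2
  have hnear : ∀ j', IsSafe n X' j' → j.val ≤ j'.val + 1 → j'.val ≤ j.val + 1 →
      ReachAvoiding (grid h l) (X ∩ X') (i, j) (i, j') := by
    intro j' hj' h1 h2
    refine reachAvoiding_row i j j' fun x h3 h4 => ?_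
    simp only [min_le_iff, le_max_iff, Fin.le_def] at h3 h4
    have hx : x = j ∨ x = j' := by simp only [Fin.ext_iff]; omega
    rcases hx with rfl | rfl
    · exact hfree i
    · exact hfree' _ hj' i
  by_cases hbar : ∃ c, IsBarrier (X ∩ X') c
  · obtain ⟨c, hc⟩ := hbar
    rcases hj.2 c (hc.mono Finset.inter_subset_left) with ⟨h1, h2⟩ | ⟨h1, h2⟩
    · obtain ⟨j', hj', h3⟩ := exists_isSafe_left (n := n) hh hX'
        (hc.mono Finset.inter_subset_right) fun i => by have := h2 i; omega
      exact ⟨j', hj', hnear j' hj' (by omega) (by omega)⟩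
    · obtain ⟨j', hj', h3⟩ := exists_isSafe_right (n := n) hh hX'
        (hc.mono Finset.inter_subset_right) fun i => by have := h2 i; omega
      exact ⟨j', hj', hnear j' hj' (by omega) (by omega)⟩
  · obtain ⟨j', hj'⟩ := exists_isSafe (n := n) hh hl hX'
    exact ⟨j', hj', reachAvoiding_of_not_isBarrier hXX' (fun c hc => hbar ⟨c, hc⟩) hfree
      (hfree' _ hj')⟩

theorem IsSafe.robberSurvives (hh : 2 ≤ h) (n : ℕ) : 2 * n + h + 3 ≤ l →
    ∀ (X : Finset ((Fin h × Fin l) ⊕ Fin (h + 1))) (i : Fin h) (j : Fin l), IsSafe n X j →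
      RobberSurvives (grid h l) (h + 1) n X (i, j) := by
  induction n with
  | zero => exact fun _ _ _ _ _ => trivial
  | succ n ih =>
    intro hl X i j hj X' hX' hXX'
    obtain ⟨j', hj', hreach⟩ := hj.exists_next (i := i) hh (by omega) hX'.le (by omega)
    exact ⟨(i, j'), hreach.robberMove fun hi => hj.1 i (Finset.mem_inter.1 hi).1, hj'.1 i,
      ih (by omega) X' i j' hj'⟩

theorem robberWins_grid {q : ℕ} (hh : 2 ≤ h) (hl : 2 * q + h + 3 ≤ l) :
    RobberWins (grid h l) (h + 1) q := by
  refine ⟨(⟨0, by omega⟩, ⟨0, by omega⟩), IsSafe.robberSurvives hh q hl _ _ _ ⟨?_, ?_⟩⟩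
  · intro i hi
    simp at hi
  · intro c hc
    have := hc.mem ⟨0, by omega⟩
    simp at this

end Grid

/-! ### Robber's strategy on a path -/

/-- The vertex `v` is free, and on its side of each cop there are at least `n + 1` vertices. -/
def IsSafeOnPath {N k : ℕ} (n : ℕ) (X : Finset (Fin N ⊕ Fin k)) (v : Fin N) : Prop :=
  ∀ x : Fin N, Sum.inl x ∈ X →
    (v.val < x.val ∧ n + 1 ≤ x.val) ∨ (x.val < v.val ∧ x.val + n + 2 ≤ N)

/-- Here `a` is the cop that stays and `b` the one that lands, so only the side of `a` must be kept.
Being enclosed between the cops does no harm, because one of them is lifted in the next round; so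
margins are counted to the ends of the path, for each cop separately. -/
theorem exists_safe_of_two_cops {N n a b v : ℕ} (hN : 2 * n + 3 ≤ N) (hv : v < N) (ha : a < N)
    (hb : b < N) (h : (v < a ∧ n + 2 ≤ a) ∨ (a < v ∧ a + n + 3 ≤ N)) :
    ∃ w < N, (v < a ↔ w < a) ∧ w ≠ a ∧
      ((w < a ∧ n + 1 ≤ a) ∨ (a < w ∧ a + n + 2 ≤ N)) ∧
      ((w < b ∧ n + 1 ≤ b) ∨ (b < w ∧ b + n + 2 ≤ N)) := by
  rcases h with h | h
  · by_cases h1 : a < b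
    · exact ⟨v, by omega⟩
    · by_cases h2 : b + 1 < a ∧ b + n + 2 ≤ N
      · exact ⟨a - 1, by omega⟩
      · exact ⟨0, by omega⟩
  · by_cases h1 : b < a
    · exact ⟨v, by omega⟩
    · by_cases h2 : a + 1 < b ∧ n + 1 ≤ b
      · exact ⟨a + 1, by omega⟩
      · exact ⟨N - 1, by omega⟩

theorem IsSafeOnPath.exists_next {N n : ℕ} {X X' : Finset (Fin N ⊕ Fin 2)} {v : Fin N}
    (hN : 2 * n + 3 ≤ N) (hv : IsSafeOnPath (n + 1) X v) (hX' : X'.card = 2)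
    (hXX' : (X ∩ X').card = 1) :
    ∃ v' : Fin N, IsSafeOnPath n X' v' ∧
      ∀ x, Sum.inl x ∈ X ∩ X' → (v.val < x.val ↔ v'.val < x.val) ∧ v' ≠ x := by
  obtain ⟨y, hy⟩ := Finset.card_eq_one.1 hXX'
  obtain ⟨d, hd⟩ := Finset.card_eq_one.1 (show (X' \ (X ∩ X')).card = 1 by
    rw [Finset.card_sdiff_of_subset Finset.inter_subset_right]
    omega)
  have hmem : ∀ z, z ∈ X' → z = y ∨ z = d := by
    intro z hz
    by_cases h : z ∈ X ∩ X'
    · rw [hy] at h; exact Or.inl (Finset.mem_singleton.1 h)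
    · have : z ∈ X' \ (X ∩ X') := Finset.mem_sdiff.2 ⟨hz, h⟩
      rw [hd] at this; exact Or.inr (Finset.mem_singleton.1 this)
  have hyX : y ∈ X := by
    have : y ∈ X ∩ X' := by rw [hy]; simp
    exact (Finset.mem_inter.1 this).1
  rw [hy]
  simp only [Finset.mem_singleton]
  cases y with
  | inr y =>
    cases d with
    | inr d =>
      refine ⟨v, fun x hx => ?_, by simp⟩
      rcases hmem _ hx with h | h <;> simp at h
    | inl b =>
      have hb : ∀ x : Fin N, Sum.inl x ∈ X' → x = b := by
        intro x hx
        rcases hmem _ hx with h | h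
        · simp at h
        · exact Sum.inl_injective h
      -- The cop that stays is off the path, so Robber may go to either end; the bound on `N` makes
      -- at least one side of `b` long enough.
      by_cases h : n + 1 ≤ b.val
      · refine ⟨⟨0, by omega⟩, fun x hx => ?_, by simp⟩
        rw [hb x hx]
        exact Or.inl ⟨by simp; omega, h⟩
      · refine ⟨⟨N - 1, by omega⟩, fun x hx => ?_, by simp⟩
        rw [hb x hx]
        exact Or.inr ⟨by simp; omega, by omega⟩
  | inl a =>
    have hav := hv a hyX
    cases d with
    | inr d =>
      refine ⟨v, fun x hx => ?_, fun x hx => ⟨Iff.rfl, ?_⟩⟩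
      · rcases hmem _ hx with h | h
        · rw [Sum.inl_injective h]; omega
        · simp at h
      · rw [Sum.inl_injective hx]
        rintro rfl
        omega
    | inl b =>
      obtain ⟨w, hw, h1, h2, h3, h4⟩ := exists_safe_of_two_cops hN v.isLt a.isLt b.isLt (by omega)
      refine ⟨⟨w, hw⟩, fun x hx => ?_, fun x hx => ?_⟩
      · rcases hmem _ hx with h | h <;> rw [Sum.inl_injective h]
        · exact h3
        · exact h4
      · rw [Sum.inl_injective hx]
        exact ⟨h1, fun h => h2 (congrArg Fin.val h)⟩

theorem IsSafeOnPath.robberSurvives {N : ℕ} (n : ℕ) : 2 * n + 1 ≤ N →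
    ∀ (X : Finset (Fin N ⊕ Fin 2)) (v : Fin N), IsSafeOnPath n X v →
      RobberSurvives (SimpleGraph.pathGraph N) 2 n X v := by
  induction n with
  | zero => exact fun _ _ _ _ => trivial
  | succ n ih =>
    intro hN X v hv X' hX' hXX'
    obtain ⟨v', hv', hside⟩ := hv.exists_next (by omega) hX' (by omega)
    have hvX : ∀ x, Sum.inl x ∈ X ∩ X' → v ≠ x := by
      rintro x hx rfl
      have := hv _ (Finset.mem_inter.1 hx).1
      omega
    refine ⟨v', ReachAvoiding.robberMove ?_ (fun h => hvX v h rfl), fun h => ?_,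
      ih (by omega) X' v' hv'⟩
    · refine reachAvoiding_of_interval id (fun _ _ h => h) v v' fun x h1 h2 hx => ?_
      have h3 := hside x hx
      have h4 := hvX x hx
      simp only [min_le_iff, le_max_iff, Fin.le_def, ne_eq, Fin.ext_iff] at h1 h2 h3 h4
      omega
    · have := hv' _ h
      omega

theorem robberWins_pathGraph {N q : ℕ} (hN : 2 * q + 1 ≤ N) :
    RobberWins (SimpleGraph.pathGraph N) 2 q := by
  refine ⟨⟨0, by omega⟩, IsSafeOnPath.robberSurvives q hN _ _ ?_⟩
  intro x hx
  simp at hx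

/-! ### Treewidth and treedepth of grids and paths, and the numerical bounds. -/

theorem TD_mono {q q' : ℕ} (h : q ≤ q') : TD q ⊆ TD q' := by
  rintro G ⟨F, hF, hq⟩
  exact ⟨F, hF, hq.trans h⟩

theorem grid_adj {h l : ℕ} {u v : Fin h × Fin l} (huv : (grid h l).Adj u v) :
    ((u.1.val + 1 = v.1.val ∨ v.1.val + 1 = u.1.val) ∧ u.2.val = v.2.val) ∨
      ((u.2.val + 1 = v.2.val ∨ v.2.val + 1 = u.2.val) ∧ u.1.val = v.1.val) := by
  rw [SimpleGraph.boxProd_adj, SimpleGraph.pathGraph_adj, SimpleGraph.pathGraph_adj] at huv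
  rcases huv with ⟨h1, h2⟩ | ⟨h1, h2⟩
  · exact Or.inl ⟨h1, by rw [h2]⟩
  · exact Or.inr ⟨h1, by rw [h2]⟩

theorem grid_mem_TW (h l : ℕ) : FinGraph.of (grid h l) ∈ TW h := by
  -- Numbering column by column, the ends of an edge differ by `1` or `h`.
  refine mem_TW_of_bandwidth (k := h + 1) (by omega) (f := fun v => h * v.2.val + v.1.val) ?_ ?_
  · rintro ⟨a, x⟩ ⟨b, y⟩ hab
    have key : ∀ (a b : Fin h) (x y : ℕ), x < y → h * x + a.val < h * y + b.val := by
      intro a b x y hxy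
      have := Nat.mul_le_mul_left h hxy
      rw [Nat.succ_eq_add_one, mul_add] at this
      omega
    dsimp only at hab
    rcases lt_trichotomy x.val y.val with hxy | hxy | hxy
    · have := key a b _ _ hxy
      omega
    · rw [hxy] at hab
      exact Prod.ext (Fin.ext (by simpa using hab)) (Fin.ext hxy)
    · have := key b a _ _ hxy
      omega
  · intro u v huv
    have := u.1.isLt
    rcases grid_adj huv with ⟨h1, h2⟩ | ⟨h1, h2⟩
    · rw [h2]
      omega
    · rcases h1 with h1 | h1
      · rw [← h1, mul_add]
        omega
      · rw [← h1, mul_add]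
        omega

theorem grid_mem_TD {h l m : ℕ} (hl : l < 2 ^ m) : FinGraph.of (grid h l) ∈ TD (h * m) := by
  refine mem_TD_of_layers (fun v => v.2.val + 1) (fun v => v.1.val)
    (fun v => ⟨by omega, by have := v.2.isLt; omega⟩) (fun v => v.1.isLt) ?_ ?_
  · intro u v h1 h2
    exact Prod.ext (Fin.ext h2) (Fin.ext (by simpa using h1))
  · intro u v huv
    have := grid_adj huv
    omega

theorem pathGraph_mem_TW (n : ℕ) : FinGraph.of (SimpleGraph.pathGraph n) ∈ TW 1 := by
  refine mem_TW_of_bandwidth (k := 2) (by omega) (f := Fin.val) Fin.val_injective ?_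
  intro u v huv
  have := SimpleGraph.pathGraph_adj.1 huv
  omega

theorem pathGraph_mem_TD {n m : ℕ} (hn : n < 2 ^ m) :
    FinGraph.of (SimpleGraph.pathGraph n) ∈ TD m := by
  have h := mem_TD_of_layers (G := SimpleGraph.pathGraph n) (h := 1) (m := m)
    (fun v => v.val + 1) (fun _ => 0) (fun v => ⟨by omega, by have := v.isLt; omega⟩)
    (fun _ => one_pos) (fun u v h _ => Fin.ext (by simpa using h)) fun u v huv => by
      have := SimpleGraph.pathGraph_adj.1 huv
      omega
  rwa [one_mul] at h

/-- The hypothesis says `q / h ≥ 3 + log q` over the reals. Rounding down loses less than `1`, which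
leaves more than `2 + log q = log (4 * q)`. -/
theorem four_mul_lt_two_pow_div {q h : ℕ} (hq : 0 < q) (hh : 0 < h)
    (hhq : (h : ℝ) ≤ (q : ℝ) / (3 + Real.logb 2 (q : ℝ))) : 4 * q < 2 ^ (q / h) := by
  have hlog : 0 ≤ Real.logb 2 (q : ℝ) :=
    Real.logb_nonneg (by norm_num) (by exact_mod_cast hq)
  have hh' : (0 : ℝ) < h := by exact_mod_cast hh
  have hq' : (0 : ℝ) < q := by exact_mod_cast hq
  have h1 : 3 + Real.logb 2 (q : ℝ) ≤ (q : ℝ) / h := by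
    rw [le_div_iff₀ (by linarith)] at hhq
    rw [le_div_iff₀ hh']
    linarith
  have h2 : (q : ℝ) / h < (q / h : ℕ) + 1 := by
    rw [div_lt_iff₀ hh']
    have : q < (q / h + 1) * h := Nat.lt_mul_of_div_lt (Nat.lt_succ_self _) hh
    exact_mod_cast this
  have h3 : Real.logb 2 (4 * q : ℝ) < (q / h : ℕ) := by
    have h4 : Real.logb 2 (4 : ℝ) = 2 := by
      rw [show (4 : ℝ) = 2 ^ (2 : ℝ) by norm_num, Real.logb_rpow (by norm_num) (by norm_num)]
    rw [Real.logb_mul (by norm_num) hq'.ne', h4]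
    linarith
  rw [Real.logb_lt_iff_lt_rpow (by norm_num) (by positivity), Real.rpow_natCast] at h3
  exact_mod_cast h3

theorem three_mul_le_of_le_div {q h : ℕ} (hq : 0 < q)
    (hhq : (h : ℝ) ≤ (q : ℝ) / (3 + Real.logb 2 (q : ℝ))) : 3 * h ≤ q := by
  have hlog : 0 ≤ Real.logb 2 (q : ℝ) :=
    Real.logb_nonneg (by norm_num) (by exact_mod_cast hq)
  rw [le_div_iff₀ (by linarith)] at hhq
  have : (0 : ℝ) ≤ h * Real.logb 2 (q : ℝ) := by positivity
  have h1 : (3 * h : ℝ) ≤ q := by linarith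
  exact_mod_cast h1

end PebbleGraphs

theorem mainTheorem3 (q : ℕ) (hq : 3 ≤ q) :
    (∀ k : ℕ, (2 : ℝ) ≤ (k : ℝ) - 1 → (k : ℝ) - 1 ≤ (q : ℝ) / (3 + Real.logb 2 (q : ℝ)) →
      PebbleClass k q ⊂ TW (k - 1) ∩ TD q ∧
      ∃ l : ℕ,
        FinGraph.of (grid (k - 1) l) ∈ (TW (k - 1) ∩ TD q) \ PebbleClass k q ∧
        RobberWins (grid (k - 1) l) k q) ∧
    (PebbleClass 2 q ⊂ TW 1 ∩ TD q ∧
      FinGraph.of (SimpleGraph.pathGraph (2 ^ q - 1)) ∈ (TW 1 ∩ TD q) \ PebbleClass 2 q ∧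
      RobberWins (SimpleGraph.pathGraph (2 ^ q - 1)) 2 q) := by
  have ssub : ∀ {A B : Set FinGraph} {G}, A ⊆ B → G ∈ B \ A → A ⊂ B :=
    fun h hG => h.ssubset_of_mem_notMem hG.1 hG.2
  constructor
  · intro k hk hkq
    obtain ⟨h, rfl⟩ : ∃ h, k = h + 1 := by
      cases k with
      | zero => norm_num at hk
      | succ h => exact ⟨h, rfl⟩
    rw [Nat.cast_add, Nat.cast_one, add_sub_cancel_right] at hk hkq
    have hh : 2 ≤ h := by exact_mod_cast hk
    have h3 : 3 * h ≤ q := three_mul_le_of_le_div (by omega) hkq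
    -- From `3 * h ≤ q` and `2 ≤ h` it follows that `2 * q + h + 3 ≤ 4 * q`.
    have hwin : RobberWins (grid h (4 * q)) (h + 1) q := robberWins_grid hh (by omega)
    have hmem : FinGraph.of (grid h (4 * q)) ∈ (TW h ∩ TD q) \ PebbleClass (h + 1) q :=
      ⟨⟨grid_mem_TW h _, TD_mono (Nat.mul_div_le q h)
        (grid_mem_TD (four_mul_lt_two_pow_div (by omega) (by omega) hkq))⟩,
        hwin.notMem_pebbleClass⟩
    exact ⟨ssub (pebbleClass_subset (by omega) q) hmem, 4 * q, hmem, hwin⟩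
  · have hpow : 2 * q + 2 ≤ 2 ^ q := by
      induction q, hq using Nat.le_induction with
      | base => norm_num
      | succ n hn ih => rw [pow_succ]; omega
    have hwin : RobberWins (SimpleGraph.pathGraph (2 ^ q - 1)) 2 q :=
      robberWins_pathGraph (by omega)
    have hmem : FinGraph.of (SimpleGraph.pathGraph (2 ^ q - 1)) ∈
        (TW 1 ∩ TD q) \ PebbleClass 2 q :=
      ⟨⟨pathGraph_mem_TW _, pathGraph_mem_TD (by omega)⟩, hwin.notMem_pebbleClass⟩
    exact ⟨ssub (pebbleClass_subset (by omega) q) hmem, hmem, hwin⟩
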